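/- Let $\mathbb{F}$ be a field. A matrix space $\mathcal{A}\le M(m\times n,\mathbb{F})$ is a linear subspace of the space of $m\times n$ matrices over $\mathbb{F}$; its rank is $\mathrm{rk}(\mathcal{A})=\max\{\mathrm{rk}(A):A\in\mathcal{A}\}$, and $\mathcal{A}_{\mathrm{reg}}=\{A\in\mathcal{A}:\mathrm{rk}(A)=\mathrm{rk}(\mathcal{A})\}$. $\mathcal{A}$ is *rank-critical* if $\mathrm{rk}(\mathcal{B})>\mathrm{rk}(\mathcal{A})$ for every matrix space $\mathcal{B}\le M(m\times n,\mathbb{F})$ with $\mathcal{B}\supsetneq\mathcal{A}$. $\mathcal{A}$ is *non-degenerate* if $\bigcap_{A\in\mathcal{A}}\ker(A)=0$ and $\mathrm{span}\bigcup_{A\in\mathcal{A}}\mathrm{im}(A)=\mathbb{F}^m$; it is *pre-primitive* if $\bigcap_{A\in\mathcal{A}_{\mathrm{reg}}}\mathrm{im}(A)=0$ and $\mathrm{span}\bigcup_{A\in\mathcal{A}_{\mathrm{reg}}}\ker(A)=\mathbb{F}^n$; it is *primitive* if it is non-degenerate and pre-primitive. Let $m_1,n_1,m_2,n_2\ge 1$,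 let $\mathcal{A}_1\le M(m_1\times n_1,\mathbb{F})$ and $\mathcal{A}_2\le M(m_2\times n_2,\mathbb{F})$ be rank-critical matrix spaces, suppose $|\mathbb{F}|\ge 2\min(m_1+m_2,\,n_1+n_2)$, and let $$\mathcal{A}_1\oplus\mathcal{A}_2=\left\{\begin{bmatrix}A_1&0\\0&A_2\end{bmatrix}:A_1\in\mathcal{A}_1,\ A_2\in\mathcal{A}_2\right\}\le M((m_1+m_2)\times(n_1+n_2),\mathbb{F}).$$ Then $\mathcal{A}_1\oplus\mathcal{A}_2$ is rank-critical if and only if both $\mathcal{A}_1$ and $\mathcal{A}_2$ are pre-primitive. In particular, if $\mathcal{A}_1$ and $\mathcal{A}_2$ are non-degenerate, then $\mathcal{A}_1\oplus\mathcal{A}_2$ is rank-critical if and only if both $\mathcal{A}_1$ and $\mathcal{A}_2$ are primitive. -/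

import Mathlib

namespace MatrixSpace

variable {F : Type*} [Field F] {m n m₁ n₁ m₂ n₂ : Type*}

/-- The rank of a matrix space: the maximum of the ranks of its elements. -/
noncomputable def rk [Fintype n] (𝒜 : Submodule F (Matrix m n F)) : ℕ :=
  sSup {r | ∃ A ∈ 𝒜, A.rank = r}

/-- The set in the definition of `rk` has a maximum, and `rk` is this maximum. -/
theorem isGreatest_rk [Fintype n] (𝒜 : Submodule F (Matrix m n F)) :
    IsGreatest {r | ∃ A ∈ 𝒜, A.rank = r} (rk 𝒜) := by
  have hb : BddAbove {r | ∃ A ∈ 𝒜, A.rank = r} := by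
    refine ⟨Fintype.card n, ?_⟩
    rintro r ⟨A, -, rfl⟩
    exact A.rank_le_card_width
  exact ⟨Nat.sSup_mem ⟨_, 0, 𝒜.zero_mem, rfl⟩ hb, fun r hr => le_csSup hb hr⟩

/-- A matrix space is rank-critical if every strictly larger matrix space of the same size has
strictly larger rank. -/
def IsRankCritical [Fintype n] (𝒜 : Submodule F (Matrix m n F)) : Prop :=
  ∀ ℬ : Submodule F (Matrix m n F), 𝒜 < ℬ → rk 𝒜 < rk ℬ

/-- The elements of maximal rank of a matrix space. -/
def reg [Fintype n] (𝒜 : Submodule F (Matrix m n F)) : Set (Matrix m n F) :=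
  {A | A ∈ 𝒜 ∧ A.rank = rk 𝒜}

/-- The kernel of a matrix, as a subspace of the space of column vectors. -/
def ker [Fintype n] (A : Matrix m n F) : Submodule F (n → F) := LinearMap.ker A.mulVecLin

/-- The image of a matrix, as a subspace of the space of column vectors. -/
def im [Fintype n] (A : Matrix m n F) : Submodule F (m → F) := LinearMap.range A.mulVecLin

/-- Non-degenerate: no common kernel vector, and the images span the whole space. -/
def IsNondegenerate [Fintype n] (𝒜 : Submodule F (Matrix m n F)) : Prop :=
  (⨅ A ∈ 𝒜, ker A) = ⊥ ∧ (⨆ A ∈ 𝒜, im A) = ⊤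

/-- Row-primitive: the images of the elements of maximal rank intersect trivially. -/
def IsRowPrimitive [Fintype n] (𝒜 : Submodule F (Matrix m n F)) : Prop :=
  (⨅ A ∈ reg 𝒜, im A) = ⊥

/-- Column-primitive: the kernels of the elements of maximal rank span the whole space. -/
def IsColumnPrimitive [Fintype n] (𝒜 : Submodule F (Matrix m n F)) : Prop :=
  (⨆ A ∈ reg 𝒜, ker A) = ⊤

/-- Pre-primitive: row-primitive and column-primitive. -/
def IsPrePrimitive [Fintype n] (𝒜 : Submodule F (Matrix m n F)) : Prop :=
  IsRowPrimitive 𝒜 ∧ IsColumnPrimitive 𝒜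

/-- Primitive: non-degenerate, row-primitive and column-primitive. -/
def IsPrimitive [Fintype n] (𝒜 : Submodule F (Matrix m n F)) : Prop :=
  IsNondegenerate 𝒜 ∧ IsRowPrimitive 𝒜 ∧ IsColumnPrimitive 𝒜

/-- The block-diagonal direct sum of two matrix spaces. -/
def blockSum (𝒜₁ : Submodule F (Matrix m₁ n₁ F)) (𝒜₂ : Submodule F (Matrix m₂ n₂ F)) :
    Submodule F (Matrix (m₁ ⊕ m₂) (n₁ ⊕ n₂) F) where
  carrier := {M | ∃ A₁ ∈ 𝒜₁, ∃ A₂ ∈ 𝒜₂, M = Matrix.fromBlocks A₁ 0 0 A₂}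
  add_mem' := by
    rintro _ _ ⟨A₁, h₁, A₂, h₂, rfl⟩ ⟨B₁, k₁, B₂, k₂, rfl⟩
    exact ⟨A₁ + B₁, 𝒜₁.add_mem h₁ k₁, A₂ + B₂, 𝒜₂.add_mem h₂ k₂, by
      simp [Matrix.fromBlocks_add]⟩
  zero_mem' := ⟨0, 𝒜₁.zero_mem, 0, 𝒜₂.zero_mem, by simp⟩
  smul_mem' := by
    rintro c _ ⟨A₁, h₁, A₂, h₂, rfl⟩
    exact ⟨c • A₁, 𝒜₁.smul_mem c h₁, c • A₂, 𝒜₂.smul_mem c h₂, by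
      simp [Matrix.fromBlocks_smul]⟩

end MatrixSpace

/-! Necessity: if a nonzero `v` lies in the image of every maximal-rank element of one summand, a
rank-one `v wᵀ` placed in an off-diagonal block can be added to the block sum without raising its
rank (`not_isRankCritical_of_rank_le_one`). Kernels that fail to span give the transposed
obstruction, a common row-space vector.

Sufficiency: let `ℬ` contain the block sum and have the same rank. Over a large field every `M ∈ ℬ`
maps `ker A` into `im A` for each maximal-rank `A` of the block sum, since otherwise some `A + t M`
has larger rank (`exists_rank_lt_rank_add_smul`). The two blocks of `A` vary independently, so
pre-primitivity kills the off-diagonal blocks of `M` (`eq_zero_of_forall_mulVec_mem_im`).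
Rank-criticality of the summands then puts the diagonal blocks where they belong. -/

namespace MatrixSpace

open Module

/-! ### Perturbation of rank and rank-one extensions -/

section General

variable {F : Type*} [Field F] {m n : Type*}

/-- A linearly independent family stays linearly independent under some nonzero perturbation in any
prescribed direction, if the field is large enough. -/
theorem exists_linearIndependent_add_smul {V : Type*} [AddCommGroup V] [Module F V] {k : ℕ}
    {u : Fin k → V} (hu : LinearIndependent F u) (w : Fin k → V)
    (hF : ((k + 2 : ℕ) : Cardinal) ≤ Cardinal.mk F) :
    ∃ t : F, t ≠ 0 ∧ LinearIndependent F fun i => u i + t • w i := by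
  classical
  -- In the coordinates `L` the perturbed family is `1 + t N`. Its determinant is a polynomial in
  -- `t` of degree at most `k` with value 1 at 0, so at most `k` roots and the value 0 must be
  -- avoided.
  obtain ⟨L, hL⟩ := (Fintype.linearCombination F u).exists_leftInverse_of_injective
    (LinearMap.ker_eq_bot.2 (LinearIndependent.fintypeLinearCombination_injective hu))
  have hLu (i : Fin k) : L (u i) = Pi.single i 1 := by
    simpa [Fintype.linearCombination_apply_single] using LinearMap.congr_fun hL (Pi.single i 1)
  let N : Matrix (Fin k) (Fin k) F := Matrix.of fun i => L (w i)
  let p : Polynomial F := Matrix.det ((Polynomial.X : Polynomial F) • N.map Polynomial.C +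
    (1 : Matrix (Fin k) (Fin k) F).map Polynomial.C)
  have hp (t : F) : p.eval t = (t • N + 1).det := by
    rw [← Polynomial.coe_evalRingHom, RingHom.map_det]
    congr 1
    ext i j
    by_cases hij : i = j <;> simp [hij, mul_comm t]
  have hp0 : p ≠ 0 := by
    intro h
    have := hp 0
    simp [h] at this
  have hdeg : p.natDegree ≤ k :=
    (Polynomial.natDegree_det_X_add_C_le N 1).trans_eq (Fintype.card_fin k)
  obtain ⟨t, ht⟩ : ∃ t : F, t ∉ insert 0 p.roots.toFinset := by
    by_contra! h
    have hs : ((insert 0 p.roots.toFinset : Finset F) : Set F) = Set.univ :=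
      Set.eq_univ_of_forall h
    have hc : Cardinal.mk F = ((insert 0 p.roots.toFinset : Finset F).card : Cardinal) := by
      rw [← Cardinal.mk_univ, ← hs]
      exact Cardinal.mk_coe_finset
    rw [hc, Nat.cast_le] at hF
    have h1 := Finset.card_insert_le 0 p.roots.toFinset
    have h2 := Multiset.toFinset_card_le p.roots
    have h3 := p.card_roots'
    omega
  simp only [Finset.mem_insert, Multiset.mem_toFinset, Polynomial.mem_roots hp0, not_or,
    Polynomial.IsRoot.def, hp] at ht
  refine ⟨t, ht.1, LinearIndependent.of_comp L ?_⟩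
  have hrows := Matrix.linearIndependent_rows_iff_isUnit.2
    ((Matrix.isUnit_iff_isUnit_det _).2 (isUnit_iff_ne_zero.2 ht.2))
  have heq : (L ∘ fun i => u i + t • w i) = (t • N + 1).row := by
    ext i j
    simp [hLu, N, Matrix.one_apply, Pi.single_apply, eq_comm, add_comm]
  rw [heq]
  exact hrows

variable [Fintype n]

theorem rank_le_rk {𝒜 : Submodule F (Matrix m n F)} {A : Matrix m n F} (hA : A ∈ 𝒜) :
    A.rank ≤ rk 𝒜 :=
  (isGreatest_rk 𝒜).2 ⟨A, hA, rfl⟩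

theorem exists_mem_rank_eq_rk (𝒜 : Submodule F (Matrix m n F)) : ∃ A ∈ 𝒜, A.rank = rk 𝒜 :=
  (isGreatest_rk 𝒜).1

theorem rank_smul_of_ne_zero {c : F} (hc : c ≠ 0) (A : Matrix m n F) :
    (c • A).rank = A.rank := by
  exact Matrix.rank_smul_of_mem_nonZeroDivisors A (mem_nonZeroDivisors_of_ne_zero hc)

theorem rank_add_le [Finite m] (A B : Matrix m n F) : (A + B).rank ≤ A.rank + B.rank := by
  simp only [Matrix.rank]
  rw [Matrix.mulVecLin_add]
  refine (Submodule.finrank_mono ?_).trans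
    (Submodule.finrank_add_le_finrank_add_finrank (LinearMap.range A.mulVecLin)
      (LinearMap.range B.mulVecLin))
  rintro _ ⟨x, rfl⟩
  exact Submodule.add_mem_sup ⟨x, rfl⟩ ⟨x, rfl⟩

theorem le_rank_of_linearIndependent [Finite m] {k : ℕ} {A : Matrix m n F} {v : Fin k → m → F}
    (hv : LinearIndependent F v) (hA : ∀ i, v i ∈ im A) : k ≤ A.rank := by
  have h : LinearIndependent F fun i => (⟨v i, hA i⟩ : im A) :=
    LinearIndependent.of_comp (im A).subtype hv
  have h' := h.fintype_card_le_finrank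
  rwa [Fintype.card_fin] at h'

theorem exists_linearIndependent_mulVec (A : Matrix m n F) :
    ∃ x : Fin A.rank → n → F, LinearIndependent F fun i => A.mulVecLin (x i) := by
  let b : Basis (Fin A.rank) F (LinearMap.range A.mulVecLin) := finBasis F _
  choose x hx using fun i => (b i).2
  refine ⟨x, ?_⟩
  simp only [hx]
  exact b.linearIndependent.map' (LinearMap.range A.mulVecLin).subtype (Submodule.ker_subtype _)

/-- Some matrix `A + t M` with `t ≠ 0` has at least the rank of `A`. -/
theorem exists_rank_le_rank_add_smul [Finite m] (A M : Matrix m n F)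
    (hF : ((A.rank + 2 : ℕ) : Cardinal) ≤ Cardinal.mk F) :
    ∃ t : F, t ≠ 0 ∧ A.rank ≤ (A + t • M).rank := by
  obtain ⟨x, hx⟩ := exists_linearIndependent_mulVec A
  obtain ⟨t, ht, h⟩ := exists_linearIndependent_add_smul hx (fun i => M.mulVecLin (x i)) hF
  refine ⟨t, ht, le_rank_of_linearIndependent h fun i => ⟨x i, ?_⟩⟩
  simp

/-- If `M` does not map the kernel of `A` into the image of `A`, then some `A + t M` with `t ≠ 0`
has larger rank than `A`. -/
theorem exists_rank_lt_rank_add_smul [Finite m] {A M : Matrix m n F}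
    (hF : ((A.rank + 3 : ℕ) : Cardinal) ≤ Cardinal.mk F) {x : n → F} (hx : x ∈ ker A)
    (hMx : M.mulVecLin x ∉ im A) : ∃ t : F, t ≠ 0 ∧ A.rank < (A + t • M).rank := by
  obtain ⟨y, hy⟩ := exists_linearIndependent_mulVec A
  have hu : LinearIndependent F
      (Fin.cons (M.mulVecLin x) fun i => A.mulVecLin (y i) : Fin (A.rank + 1) → m → F) := by
    refine linearIndependent_finCons.2 ⟨hy, fun h => hMx ?_⟩
    refine Submodule.span_le.2 ?_ h
    rintro _ ⟨i, rfl⟩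
    exact ⟨y i, rfl⟩
  -- The direction is 0 at `M x` because `A x = 0` already gives `(A + t M)(t⁻¹ x) = M x`.
  obtain ⟨t, ht, h⟩ := exists_linearIndependent_add_smul hu
    (Fin.cons 0 fun i => M.mulVecLin (y i)) hF
  refine ⟨t, ht, le_rank_of_linearIndependent h fun i => ?_⟩
  have hx0 : A.mulVec x = 0 := hx
  refine Fin.cases ?_ (fun i => ?_) i
  · refine ⟨t⁻¹ • x, ?_⟩
    simp [hx0, smul_smul, ht]
  · refine ⟨y i, ?_⟩
    simp

/-- A matrix space is not rank-critical if it can be enlarged by a matrix `N` of rank at most one that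
is a left or right multiple of every element of maximal rank. -/
theorem not_isRankCritical_of_rank_le_one [Fintype m] {𝒜 : Submodule F (Matrix m n F)}
    {N : Matrix m n F} (hN : N ∉ 𝒜) (hr : N.rank ≤ 1)
    (h : ∀ A ∈ reg 𝒜, (∃ K : Matrix n n F, N = A * K) ∨ ∃ K : Matrix m m F, N = K * A) :
    ¬ IsRankCritical 𝒜 := by
  classical
  intro hc
  have hlt : 𝒜 < 𝒜 ⊔ Submodule.span F {N} :=
    lt_of_le_of_ne le_sup_left fun he =>
      hN (he ▸ Submodule.mem_sup_right (Submodule.mem_span_singleton_self N))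
  refine (hc _ hlt).not_ge ?_
  obtain ⟨B, hB, hBr⟩ := exists_mem_rank_eq_rk (𝒜 ⊔ Submodule.span F {N})
  rw [← hBr]
  obtain ⟨A, hA, _, hcN, rfl⟩ := Submodule.mem_sup.1 hB
  obtain ⟨c, rfl⟩ := Submodule.mem_span_singleton.1 hcN
  -- At maximal rank, adding `c N` amounts to multiplying by `1 + c K`; below it, there is room for
  -- one more rank.
  by_cases hreg : A.rank = rk 𝒜
  · rw [← hreg]
    rcases h A ⟨hA, hreg⟩ with ⟨K, hK⟩ | ⟨K, hK⟩
    · have : A + c • N = A * (1 + c • K) := by rw [hK]; simp [Matrix.mul_add]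
      exact this ▸ Matrix.rank_mul_le_left _ _
    · have : A + c • N = (1 + c • K) * A := by rw [hK]; simp [Matrix.add_mul]
      exact this ▸ Matrix.rank_mul_le_right _ _
  · have h1 := rank_le_rk hA
    have h2 := rank_add_le A (c • N)
    have h3 : (c • N).rank ≤ 1 := by
      have : c • N = N * (c • (1 : Matrix n n F)) := by simp
      exact this ▸ (Matrix.rank_mul_le_left _ _).trans hr
    omega

theorem not_isRankCritical_of_vecMulVec_of_mulVec [Fintype m] {𝒜 : Submodule F (Matrix m n F)}
    {v : m → F} {w : n → F} (hN : Matrix.vecMulVec v w ∉ 𝒜)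
    (h : ∀ A ∈ reg 𝒜, ∃ y, Matrix.mulVec A y = v) : ¬ IsRankCritical 𝒜 := by
  refine not_isRankCritical_of_rank_le_one hN (Matrix.rank_vecMulVec_le v w) fun A hA => Or.inl ?_
  obtain ⟨y, hy⟩ := h A hA
  exact ⟨Matrix.vecMulVec y w, by rw [Matrix.mul_vecMulVec, hy]⟩

theorem not_isRankCritical_of_vecMulVec_of_vecMul [Fintype m] {𝒜 : Submodule F (Matrix m n F)}
    {v : m → F} {w : n → F} (hN : Matrix.vecMulVec v w ∉ 𝒜)
    (h : ∀ A ∈ reg 𝒜, ∃ y, Matrix.vecMul y A = w) : ¬ IsRankCritical 𝒜 := by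
  refine not_isRankCritical_of_rank_le_one hN (Matrix.rank_vecMulVec_le v w) fun A hA => Or.inr ?_
  obtain ⟨y, hy⟩ := h A hA
  exact ⟨Matrix.vecMulVec v y, by rw [Matrix.vecMulVec_mul, hy]⟩

/-- A rank-critical space with an extra matrix contains, up to a nonzero multiple of that matrix, an
element of larger rank. -/
theorem IsRankCritical.exists_rk_lt_rank {𝒜 : Submodule F (Matrix m n F)} (h : IsRankCritical 𝒜)
    {X : Matrix m n F} (hX : X ∉ 𝒜) : ∃ A ∈ 𝒜, ∃ c : F, c ≠ 0 ∧ rk 𝒜 < (A + c • X).rank := by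
  have hlt : 𝒜 < 𝒜 ⊔ Submodule.span F {X} :=
    lt_of_le_of_ne le_sup_left fun he =>
      hX (he ▸ Submodule.mem_sup_right (Submodule.mem_span_singleton_self X))
  obtain ⟨B, hB, hBr⟩ := exists_mem_rank_eq_rk (𝒜 ⊔ Submodule.span F {X})
  obtain ⟨A, hA, _, hcX, rfl⟩ := Submodule.mem_sup.1 hB
  obtain ⟨c, rfl⟩ := Submodule.mem_span_singleton.1 hcX
  have hr : rk 𝒜 < (A + c • X).rank := hBr ▸ h _ hlt
  refine ⟨A, hA, c, ?_, hr⟩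
  rintro rfl
  rw [zero_smul, add_zero] at hr
  exact hr.not_ge (rank_le_rk hA)

/-- A nonzero vector in the row space of every element of maximal rank, if the kernels of these
elements do not span. -/
theorem exists_vecMul_of_not_isColumnPrimitive [Fintype m] {𝒜 : Submodule F (Matrix m n F)}
    (h : ¬ IsColumnPrimitive 𝒜) :
    ∃ w : n → F, w ≠ 0 ∧ ∀ A ∈ reg 𝒜, ∃ y : m → F, Matrix.vecMul y A = w := by
  classical
  -- A functional vanishing on `ker A` lies in the row space of `A`; the coordinates of `f` give
  -- `w`.
  obtain ⟨f, hf0, hf⟩ := Submodule.exists_le_ker_of_lt_top _ (lt_top_iff_ne_top.2 h)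
  refine ⟨fun i => f (Pi.single i 1), fun h0 => hf0 ?_, fun A hA => ?_⟩
  · refine LinearMap.pi_ext' fun i => LinearMap.ext_ring ?_
    simpa using congrFun h0 i
  · have hmem : f ∈ (LinearMap.ker A.mulVecLin).dualAnnihilator := by
      rw [Submodule.mem_dualAnnihilator]
      intro x hx
      exact hf ((le_iSup₂_of_le (f := fun A (_ : A ∈ reg 𝒜) => ker A) A hA le_rfl) hx)
    rw [← LinearMap.range_dualMap_eq_dualAnnihilator_ker] at hmem
    obtain ⟨g, hg⟩ := hmem
    refine ⟨fun i => g fun j => if i = j then 1 else 0, ?_⟩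
    ext j
    have hgj : f (Pi.single j 1) = g (A.col j) := by simp [← hg]
    rw [hgj, LinearMap.pi_apply_eq_sum_univ g (A.col j)]
    simp [Matrix.vecMul, dotProduct, mul_comm]

/-- A nonzero vector in the image of every element of maximal rank, if these images do not
intersect trivially. -/
theorem exists_mulVec_of_not_isRowPrimitive {𝒜 : Submodule F (Matrix m n F)}
    (h : ¬ IsRowPrimitive 𝒜) :
    ∃ v : m → F, v ≠ 0 ∧ ∀ A ∈ reg 𝒜, ∃ y : n → F, Matrix.mulVec A y = v := by
  obtain ⟨v, hv, hv0⟩ := (Submodule.ne_bot_iff _).1 h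
  refine ⟨v, hv0, fun A hA => ?_⟩
  exact (iInf₂_le (f := fun A (_ : A ∈ reg 𝒜) => im A) A hA) hv

end General

/-! ### Ranks and maximal-rank elements of block sums -/

section BlockSum

variable {F : Type*} [Field F] {m₁ n₁ m₂ n₂ : Type*}

theorem vecMulVec_inl_inr_notMem_blockSum {𝒜₁ : Submodule F (Matrix m₁ n₁ F)}
    {𝒜₂ : Submodule F (Matrix m₂ n₂ F)} {v : m₁ → F} {w : n₂ → F} (hv : v ≠ 0) (hw : w ≠ 0) :
    Matrix.vecMulVec (Sum.elim v 0) (Sum.elim 0 w) ∉ blockSum 𝒜₁ 𝒜₂ := by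
  rintro ⟨A, -, B, -, h⟩
  obtain ⟨i, hi⟩ := Function.ne_iff.1 hv
  obtain ⟨j, hj⟩ := Function.ne_iff.1 hw
  have := congrFun (congrFun h (Sum.inl i)) (Sum.inr j)
  simp [Matrix.vecMulVec_apply] at this
  tauto

theorem vecMulVec_inr_inl_notMem_blockSum {𝒜₁ : Submodule F (Matrix m₁ n₁ F)}
    {𝒜₂ : Submodule F (Matrix m₂ n₂ F)} {v : m₂ → F} {w : n₁ → F} (hv : v ≠ 0) (hw : w ≠ 0) :
    Matrix.vecMulVec (Sum.elim 0 v) (Sum.elim w 0) ∉ blockSum 𝒜₁ 𝒜₂ := by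
  rintro ⟨A, -, B, -, h⟩
  obtain ⟨i, hi⟩ := Function.ne_iff.1 hv
  obtain ⟨j, hj⟩ := Function.ne_iff.1 hw
  have := congrFun (congrFun h (Sum.inr i)) (Sum.inl j)
  simp [Matrix.vecMulVec_apply] at this
  tauto

variable [Fintype n₁] [Fintype n₂]

theorem rank_fromBlocks_diagonal [Finite m₁] [Finite m₂] (A : Matrix m₁ n₁ F) (B : Matrix m₂ n₂ F) :
    (Matrix.fromBlocks A 0 0 B).rank = A.rank + B.rank := by
  let φ : (LinearMap.range A.mulVecLin × LinearMap.range B.mulVecLin) →ₗ[F] (m₁ ⊕ m₂ → F) :=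
    (LinearEquiv.sumArrowLequivProdArrow m₁ m₂ F F).symm.toLinearMap ∘ₗ
      (LinearMap.range A.mulVecLin).subtype.prodMap (LinearMap.range B.mulVecLin).subtype
  have hφ : Function.Injective φ :=
    (LinearEquiv.sumArrowLequivProdArrow m₁ m₂ F F).symm.injective.comp
      (Function.Injective.prodMap Subtype.val_injective Subtype.val_injective)
  have hrange : LinearMap.range (Matrix.fromBlocks A 0 0 B).mulVecLin = LinearMap.range φ := by
    ext z
    constructor
    · rintro ⟨x, rfl⟩
      refine ⟨(⟨_, x ∘ Sum.inl, rfl⟩, ⟨_, x ∘ Sum.inr, rfl⟩), ?_⟩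
      ext (i | i) <;> simp [φ, Matrix.fromBlocks_mulVec]
    · rintro ⟨⟨⟨_, x, rfl⟩, ⟨_, y, rfl⟩⟩, rfl⟩
      refine ⟨Sum.elim x y, ?_⟩
      ext (i | i) <;> simp [φ, Matrix.fromBlocks_mulVec]
  rw [Matrix.rank, hrange, LinearMap.finrank_range_of_inj hφ, Module.finrank_prod]
  rfl

theorem rk_blockSum [Finite m₁] [Finite m₂] (𝒜₁ : Submodule F (Matrix m₁ n₁ F)) (𝒜₂ : Submodule F (Matrix m₂ n₂ F)) :
    rk (blockSum 𝒜₁ 𝒜₂) = rk 𝒜₁ + rk 𝒜₂ := by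
  apply le_antisymm
  · obtain ⟨_, ⟨A, hA, B, hB, rfl⟩, hr⟩ := exists_mem_rank_eq_rk (blockSum 𝒜₁ 𝒜₂)
    rw [← hr, rank_fromBlocks_diagonal]
    exact add_le_add (rank_le_rk hA) (rank_le_rk hB)
  · obtain ⟨A, hA, hr₁⟩ := exists_mem_rank_eq_rk 𝒜₁
    obtain ⟨B, hB, hr₂⟩ := exists_mem_rank_eq_rk 𝒜₂
    rw [← hr₁, ← hr₂, ← rank_fromBlocks_diagonal]
    exact rank_le_rk ⟨A, hA, B, hB, rfl⟩

/-- Ranks add over the blocks, so the sum is maximal only when both terms are. -/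
theorem mem_reg_blockSum [Finite m₁] [Finite m₂] {𝒜₁ : Submodule F (Matrix m₁ n₁ F)} {𝒜₂ : Submodule F (Matrix m₂ n₂ F)}
    {M : Matrix (m₁ ⊕ m₂) (n₁ ⊕ n₂) F} :
    M ∈ reg (blockSum 𝒜₁ 𝒜₂) ↔
      ∃ A ∈ reg 𝒜₁, ∃ B ∈ reg 𝒜₂, M = Matrix.fromBlocks A 0 0 B := by
  constructor
  · rintro ⟨⟨A, hA, B, hB, rfl⟩, hr⟩
    rw [rk_blockSum, rank_fromBlocks_diagonal] at hr
    have h₁ := rank_le_rk hA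
    have h₂ := rank_le_rk hB
    exact ⟨A, ⟨hA, by omega⟩, B, ⟨hB, by omega⟩, rfl⟩
  · rintro ⟨A, hA, B, hB, rfl⟩
    refine ⟨⟨A, hA.1, B, hB.1, rfl⟩, ?_⟩
    rw [rk_blockSum, rank_fromBlocks_diagonal, hA.2, hB.2]

/-! ### Necessity of pre-primitivity -/

theorem IsRankCritical.isPrePrimitive_of_blockSum [Fintype m₁] [Fintype m₂] [Nonempty m₁]
    [Nonempty m₂] [Nonempty n₁] [Nonempty n₂] {𝒜₁ : Submodule F (Matrix m₁ n₁ F)}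
    {𝒜₂ : Submodule F (Matrix m₂ n₂ F)} (h : IsRankCritical (blockSum 𝒜₁ 𝒜₂)) :
    IsPrePrimitive 𝒜₁ ∧ IsPrePrimitive 𝒜₂ := by
  refine ⟨⟨?_, ?_⟩, ?_, ?_⟩ <;> by_contra hp
  · obtain ⟨v, hv, hy⟩ := exists_mulVec_of_not_isRowPrimitive hp
    -- The all-ones vector serves only as some nonzero vector.
    refine not_isRankCritical_of_vecMulVec_of_mulVec
      (vecMulVec_inl_inr_notMem_blockSum hv (one_ne_zero (α := n₂ → F))) (fun M hM => ?_) h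
    obtain ⟨A, hA, B, -, rfl⟩ := mem_reg_blockSum.1 hM
    obtain ⟨y, hy⟩ := hy A hA
    exact ⟨Sum.elim y 0, by simp [Matrix.fromBlocks_mulVec, hy]⟩
  · obtain ⟨w, hw, hy⟩ := exists_vecMul_of_not_isColumnPrimitive hp
    refine not_isRankCritical_of_vecMulVec_of_vecMul
      (vecMulVec_inr_inl_notMem_blockSum (one_ne_zero (α := m₂ → F)) hw) (fun M hM => ?_) h
    obtain ⟨A, hA, B, -, rfl⟩ := mem_reg_blockSum.1 hM
    obtain ⟨y, hy⟩ := hy A hA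
    exact ⟨Sum.elim y 0, by simp [Matrix.vecMul_fromBlocks, hy]⟩
  · obtain ⟨v, hv, hy⟩ := exists_mulVec_of_not_isRowPrimitive hp
    refine not_isRankCritical_of_vecMulVec_of_mulVec
      (vecMulVec_inr_inl_notMem_blockSum hv (one_ne_zero (α := n₁ → F))) (fun M hM => ?_) h
    obtain ⟨A, -, B, hB, rfl⟩ := mem_reg_blockSum.1 hM
    obtain ⟨y, hy⟩ := hy B hB
    exact ⟨Sum.elim 0 y, by simp [Matrix.fromBlocks_mulVec, hy]⟩
  · obtain ⟨w, hw, hy⟩ := exists_vecMul_of_not_isColumnPrimitive hp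
    refine not_isRankCritical_of_vecMulVec_of_vecMul
      (vecMulVec_inl_inr_notMem_blockSum (one_ne_zero (α := m₁ → F)) hw) (fun M hM => ?_) h
    obtain ⟨A, -, B, hB, rfl⟩ := mem_reg_blockSum.1 hM
    obtain ⟨y, hy⟩ := hy B hB
    exact ⟨Sum.elim 0 y, by simp [Matrix.vecMul_fromBlocks, hy]⟩

/-! ### Sufficiency of pre-primitivity -/

/-- A matrix that maps the kernel of every element of maximal rank of one space into the image of
every element of maximal rank of another space vanishes, under primitivity. -/
theorem eq_zero_of_forall_mulVec_mem_im {𝒜₁ : Submodule F (Matrix m₁ n₁ F)}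
    {𝒜₂ : Submodule F (Matrix m₂ n₂ F)} (hr : IsRowPrimitive 𝒜₁) (hc : IsColumnPrimitive 𝒜₂)
    {Y : Matrix m₁ n₂ F}
    (hY : ∀ A ∈ reg 𝒜₁, ∀ B ∈ reg 𝒜₂, ∀ x ∈ ker B, Y.mulVecLin x ∈ im A) : Y = 0 := by
  classical
  have hle : (⨆ B ∈ reg 𝒜₂, ker B) ≤ LinearMap.ker Y.mulVecLin := by
    refine iSup₂_le fun B hB x hx => ?_
    have hmem : Y.mulVecLin x ∈ ⨅ A ∈ reg 𝒜₁, im A := by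
      simp only [Submodule.mem_iInf]
      exact fun A hA => hY A hA B hB x hx
    rw [hr, Submodule.mem_bot] at hmem
    exact hmem
  rw [hc, top_le_iff, LinearMap.ker_eq_top] at hle
  refine Matrix.ext_of_mulVec_single fun i => ?_
  rw [Matrix.zero_mulVec]
  exact LinearMap.congr_fun hle (Pi.single i 1)

/-- If a matrix space contains a block sum and has no larger rank, the first diagonal block of each
block-diagonal element lies in the first summand. -/
theorem IsRankCritical.mem_of_fromBlocks_mem_left [Finite m₁] [Finite m₂]
    {𝒜₁ : Submodule F (Matrix m₁ n₁ F)}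
    {𝒜₂ : Submodule F (Matrix m₂ n₂ F)} (h : IsRankCritical 𝒜₁)
    (hF : ((rk 𝒜₂ + 2 : ℕ) : Cardinal) ≤ Cardinal.mk F)
    {ℬ : Submodule F (Matrix (m₁ ⊕ m₂) (n₁ ⊕ n₂) F)} (hle : blockSum 𝒜₁ 𝒜₂ ≤ ℬ)
    (hrk : rk ℬ ≤ rk 𝒜₁ + rk 𝒜₂) {X : Matrix m₁ n₁ F} {W : Matrix m₂ n₂ F}
    (hM : Matrix.fromBlocks X 0 0 W ∈ ℬ) : X ∈ 𝒜₁ := by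
  by_contra hX
  obtain ⟨A, hA, c, hc, hr⟩ := h.exists_rk_lt_rank hX
  obtain ⟨B, hB, hBr⟩ := exists_mem_rank_eq_rk 𝒜₂
  rw [← hBr] at hF hrk
  obtain ⟨t, ht, htr⟩ := exists_rank_le_rank_add_smul B W hF
  -- `X` and `W` must carry the same coefficient `c`; scaling by `c * t⁻¹` achieves this and
  -- preserves the rank of the second block.
  have hmem : Matrix.fromBlocks (A + c • X) 0 0 ((c * t⁻¹) • (B + t • W)) ∈ ℬ := by
    have : Matrix.fromBlocks (A + c • X) 0 0 ((c * t⁻¹) • (B + t • W)) =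
        Matrix.fromBlocks A 0 0 ((c * t⁻¹) • B) + c • Matrix.fromBlocks X 0 0 W := by
      simp [Matrix.fromBlocks_smul, Matrix.fromBlocks_add, smul_smul, ht]
    rw [this]
    exact ℬ.add_mem (hle ⟨A, hA, _, 𝒜₂.smul_mem _ hB, rfl⟩) (ℬ.smul_mem c hM)
  have hle' := rank_le_rk hmem
  rw [rank_fromBlocks_diagonal, rank_smul_of_ne_zero (mul_ne_zero hc (inv_ne_zero ht))] at hle'
  omega

theorem IsRankCritical.mem_of_fromBlocks_mem_right [Finite m₁] [Finite m₂]
    {𝒜₁ : Submodule F (Matrix m₁ n₁ F)}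
    {𝒜₂ : Submodule F (Matrix m₂ n₂ F)} (h : IsRankCritical 𝒜₂)
    (hF : ((rk 𝒜₁ + 2 : ℕ) : Cardinal) ≤ Cardinal.mk F)
    {ℬ : Submodule F (Matrix (m₁ ⊕ m₂) (n₁ ⊕ n₂) F)} (hle : blockSum 𝒜₁ 𝒜₂ ≤ ℬ)
    (hrk : rk ℬ ≤ rk 𝒜₁ + rk 𝒜₂) {X : Matrix m₁ n₁ F} {W : Matrix m₂ n₂ F}
    (hM : Matrix.fromBlocks X 0 0 W ∈ ℬ) : W ∈ 𝒜₂ := by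
  by_contra hW
  obtain ⟨B, hB, c, hc, hr⟩ := h.exists_rk_lt_rank hW
  obtain ⟨A, hA, hAr⟩ := exists_mem_rank_eq_rk 𝒜₁
  rw [← hAr] at hF hrk
  obtain ⟨t, ht, htr⟩ := exists_rank_le_rank_add_smul A X hF
  have hmem : Matrix.fromBlocks ((c * t⁻¹) • (A + t • X)) 0 0 (B + c • W) ∈ ℬ := by
    have : Matrix.fromBlocks ((c * t⁻¹) • (A + t • X)) 0 0 (B + c • W) =
        Matrix.fromBlocks ((c * t⁻¹) • A) 0 0 B + c • Matrix.fromBlocks X 0 0 W := by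
      simp [Matrix.fromBlocks_smul, Matrix.fromBlocks_add, smul_smul, ht]
    rw [this]
    exact ℬ.add_mem (hle ⟨_, 𝒜₁.smul_mem _ hA, B, hB, rfl⟩) (ℬ.smul_mem c hM)
  have hle' := rank_le_rk hmem
  rw [rank_fromBlocks_diagonal, rank_smul_of_ne_zero (mul_ne_zero hc (inv_ne_zero ht))] at hle'
  omega

/-- A block sum of pre-primitive rank-critical spaces is rank-critical over large fields. -/
theorem IsRankCritical.blockSum_of_isPrePrimitive [Fintype m₁] [Fintype m₂]
    [Nonempty m₁] [Nonempty m₂] [Nonempty n₁] [Nonempty n₂]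
    {𝒜₁ : Submodule F (Matrix m₁ n₁ F)} {𝒜₂ : Submodule F (Matrix m₂ n₂ F)}
    (h₁ : IsRankCritical 𝒜₁) (h₂ : IsRankCritical 𝒜₂)
    (hF : ((2 * min (Fintype.card m₁ + Fintype.card m₂) (Fintype.card n₁ + Fintype.card n₂) : ℕ) :
      Cardinal) ≤ Cardinal.mk F)
    (hp₁ : IsPrePrimitive 𝒜₁) (hp₂ : IsPrePrimitive 𝒜₂) :
    IsRankCritical (blockSum 𝒜₁ 𝒜₂) := by
  intro ℬ hℬ
  by_contra! hrk
  have hcard {k : ℕ} (hk : k ≤ 2 * min (Fintype.card m₁ + Fintype.card m₂)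
      (Fintype.card n₁ + Fintype.card n₂)) : (k : Cardinal) ≤ Cardinal.mk F :=
    (Nat.cast_le.2 hk).trans hF
  have hm₁ := Fintype.card_pos (α := m₁)
  have hm₂ := Fintype.card_pos (α := m₂)
  have hn₁ := Fintype.card_pos (α := n₁)
  have hn₂ := Fintype.card_pos (α := n₂)
  have hkey {M} (hM : M ∈ ℬ) {A} (hA : A ∈ reg (blockSum 𝒜₁ 𝒜₂)) {x} (hx : x ∈ ker A) :
      M.mulVecLin x ∈ im A := by
    by_contra hMx
    -- A failure forces `A.rank` strictly below both dimensions. As their minimum is at least 2,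
    -- twice it is at least `A.rank + 3`.
    have hm : A.rank < Fintype.card m₁ + Fintype.card m₂ := by
      have hne : im A ≠ ⊤ := fun h => hMx (h ▸ Submodule.mem_top)
      have := Submodule.finrank_lt hne
      rwa [finrank_fintype_fun_eq_card, Fintype.card_sum] at this
    have hn : A.rank < Fintype.card n₁ + Fintype.card n₂ := by
      have hne : ker A ≠ ⊥ := by
        intro h
        rw [h, Submodule.mem_bot] at hx
        exact hMx (by rw [hx, map_zero]; exact zero_mem _)
      have h0 : 0 < finrank F (ker A) := Submodule.one_le_finrank_iff.2 hne
      have := LinearMap.finrank_range_add_finrank_ker A.mulVecLin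
      rw [finrank_fintype_fun_eq_card, Fintype.card_sum] at this
      change A.rank + finrank F (ker A) = _ at this
      omega
    obtain ⟨t, -, ht⟩ := exists_rank_lt_rank_add_smul (hcard (by omega)) hx hMx
    have := rank_le_rk (ℬ.add_mem (hℬ.le hA.1) (ℬ.smul_mem t hM))
    have := hA.2
    omega
  refine hℬ.not_ge fun M hM => ?_
  have hreg {A} (hA : A ∈ reg 𝒜₁) {B} (hB : B ∈ reg 𝒜₂) :
      Matrix.fromBlocks A 0 0 B ∈ reg (blockSum 𝒜₁ 𝒜₂) :=
    mem_reg_blockSum.2 ⟨A, hA, B, hB, rfl⟩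
  rw [← M.fromBlocks_toBlocks] at hM ⊢
  have hY : M.toBlocks₁₂ = 0 := by
    refine eq_zero_of_forall_mulVec_mem_im hp₁.1 hp₂.2 fun A hA B hB x hx => ?_
    have hx0 : Matrix.mulVec B x = 0 := hx
    obtain ⟨y, hy⟩ := hkey hM (hreg hA hB) (x := Sum.elim 0 x) (by
      simp [ker, Matrix.fromBlocks_mulVec, hx0])
    refine ⟨y ∘ Sum.inl, ?_⟩
    ext i
    simpa [Matrix.fromBlocks_mulVec] using congrFun hy (Sum.inl i)
  have hZ : M.toBlocks₂₁ = 0 := by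
    refine eq_zero_of_forall_mulVec_mem_im hp₂.1 hp₁.2 fun B hB A hA x hx => ?_
    have hx0 : Matrix.mulVec A x = 0 := hx
    obtain ⟨y, hy⟩ := hkey hM (hreg hA hB) (x := Sum.elim x 0) (by
      simp [ker, Matrix.fromBlocks_mulVec, hx0])
    refine ⟨y ∘ Sum.inr, ?_⟩
    ext i
    simpa [Matrix.fromBlocks_mulVec] using congrFun hy (Sum.inr i)
  rw [hY, hZ] at hM ⊢
  rw [rk_blockSum] at hrk
  have hr₁ : rk 𝒜₁ ≤ Fintype.card m₁ ∧ rk 𝒜₁ ≤ Fintype.card n₁ := by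
    obtain ⟨A, -, hA⟩ := exists_mem_rank_eq_rk 𝒜₁
    exact hA ▸ ⟨A.rank_le_card_height, A.rank_le_card_width⟩
  have hr₂ : rk 𝒜₂ ≤ Fintype.card m₂ ∧ rk 𝒜₂ ≤ Fintype.card n₂ := by
    obtain ⟨A, -, hA⟩ := exists_mem_rank_eq_rk 𝒜₂
    exact hA ▸ ⟨A.rank_le_card_height, A.rank_le_card_width⟩
  exact ⟨_, h₁.mem_of_fromBlocks_mem_left (hcard (by omega)) hℬ.le hrk hM,
    _, h₂.mem_of_fromBlocks_mem_right (hcard (by omega)) hℬ.le hrk hM, rfl⟩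

end BlockSum

end MatrixSpace

theorem theorem5 {F : Type*} [Field F] (m₁ n₁ m₂ n₂ : ℕ)
    (hm₁ : 0 < m₁) (hn₁ : 0 < n₁) (hm₂ : 0 < m₂) (hn₂ : 0 < n₂)
    (𝒜₁ : Submodule F (Matrix (Fin m₁) (Fin n₁) F))
    (𝒜₂ : Submodule F (Matrix (Fin m₂) (Fin n₂) F))
    (h₁ : MatrixSpace.IsRankCritical 𝒜₁) (h₂ : MatrixSpace.IsRankCritical 𝒜₂)
    (hF : ((2 * min (m₁ + m₂) (n₁ + n₂) : ℕ) : Cardinal) ≤ Cardinal.mk F) :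
    (MatrixSpace.IsRankCritical (MatrixSpace.blockSum 𝒜₁ 𝒜₂) ↔
      MatrixSpace.IsPrePrimitive 𝒜₁ ∧ MatrixSpace.IsPrePrimitive 𝒜₂) ∧
    (MatrixSpace.IsNondegenerate 𝒜₁ → MatrixSpace.IsNondegenerate 𝒜₂ →
      (MatrixSpace.IsRankCritical (MatrixSpace.blockSum 𝒜₁ 𝒜₂) ↔
        MatrixSpace.IsPrimitive 𝒜₁ ∧ MatrixSpace.IsPrimitive 𝒜₂)) := by
  have := Fin.pos_iff_nonempty.1 hm₁
  have := Fin.pos_iff_nonempty.1 hn₁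
  have := Fin.pos_iff_nonempty.1 hm₂
  have := Fin.pos_iff_nonempty.1 hn₂
  have h : MatrixSpace.IsRankCritical (MatrixSpace.blockSum 𝒜₁ 𝒜₂) ↔
      MatrixSpace.IsPrePrimitive 𝒜₁ ∧ MatrixSpace.IsPrePrimitive 𝒜₂ :=
    ⟨fun h => h.isPrePrimitive_of_blockSum,
      fun hp => h₁.blockSum_of_isPrePrimitive h₂ (by simpa using hF) hp.1 hp.2⟩
  exact ⟨h, fun hd₁ hd₂ => h.trans
    ⟨fun hp => ⟨⟨hd₁, hp.1⟩, hd₂, hp.2⟩, fun hp => ⟨hp.1.2, hp.2.2⟩⟩⟩
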